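/- Let $n\ge 1$. For $X\in\mathbb R^{n\times n}$ let $|X|$ be the entrywise absolute value of $X$, let $\mathbb 1_n$ be the all-ones vector, and let $\mathcal S_{\text{nz-row}}$ be the set of $X\in\mathbb R^{n\times n}$ none of whose rows is zero. The homophily-based model is the dynamical system on $\mathcal S_{\text{nz-row}}$ $$X(t+1)=f(X(t)),\qquad f(X)=\operatorname{diag}(|X|\mathbb 1_n)^{-1}XX^{\top},\qquad t=0,1,2,\dots$$ Let $Q$ be the set of all matrices $PYP^{\top}\in\mathcal S_{\text{nz-row}}$, where $P$ is an $n\times n$ permutation matrix and $Y$ is an $n\times n$ block diagonal matrix each of whose diagonal blocks has the form $\alpha bb^{\top}$ with $\alpha>0$ and $b\in\{-1,+1\}^m$ for some $1\le m\le n$ ($\alpha$, $b$ and $m$ may differ from block to block). The network $G(X)$, i.e. the weighted digraph with adjacency matrix $X$, is called structurally balanced if $X_{ii}>0$ for all $i$ and $\operatorname{sign}(X_{ij})\operatorname{sign}(X_{jk})\operatorname{sign}(X_{ki})=1$ for all $i,j,k$. A fixed point $X^*$ of $f$ is called locally stable if for every $\varepsilon>0$ there is $\delta>0$ such that every solution with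 $\max_{i,j}|X_{ij}(0)-X^*_{ij}|<\delta$ satisfies $\max_{i,j}|X_{ij}(t)-X^*_{ij}|<\varepsilon$ for all $t\ge 0$. Then: (i) Every element of $Q$ of rank one is a fixed point of $f$ and is locally stable. (ii) For every $X(0)\in\mathcal S_{\text{nz-row}}$, with $X(t)$ the resulting solution, the following three statements are equivalent: (a) $\liminf_{t\to\infty}\min_{i,j}|X_{ij}(t)|>0$; (b) there exists $t_0>0$ such that $G(X(t))$ is structurally balanced for all $t\ge t_0$; (c) there exists $X^*\in Q$ of rank one such that $\lim_{t\to\infty}X(t)=X^*$. -/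

import Mathlib

open Filter Topology

namespace HbM

/-- Matrices all of whose rows are nonzero. -/
def nzRow (n : ℕ) : Set (Matrix (Fin n) (Fin n) ℝ) :=
  {X | ∀ i, X i ≠ 0}

/-- The homophily-based update `diag(|X| 𝟙)⁻¹ X Xᵀ`, with `|X|` the entrywise absolute value.
For `X ∈ nzRow n` the diagonal matrix is invertible. -/
noncomputable def update {n : ℕ} (X : Matrix (Fin n) (Fin n) ℝ) : Matrix (Fin n) (Fin n) ℝ :=
  (Matrix.diagonal (Matrix.mulVec (X.map fun x => |x|) 1))⁻¹ * X * X.transpose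

/-- `X(0), X(1), …` is a solution of the homophily-based model. -/
def IsSolution {n : ℕ} (X : ℕ → Matrix (Fin n) (Fin n) ℝ) : Prop :=
  ∀ t, X (t + 1) = update (X t)

/-- The max norm `max_{i,j} |X_ij|` (for `n ≥ 1`). -/
noncomputable def maxNorm {n : ℕ} (X : Matrix (Fin n) (Fin n) ℝ) : ℝ :=
  ⨆ p : Fin n × Fin n, |X p.1 p.2|

/-- The smallest absolute value of an entry, `min_{i,j} |X_ij|` (for `n ≥ 1`). -/
noncomputable def minAbs {n : ℕ} (X : Matrix (Fin n) (Fin n) ℝ) : ℝ :=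
  ⨅ p : Fin n × Fin n, |X p.1 p.2|

/-- Social balance of the appraisal network `G(X)` with weighted adjacency matrix `X`. -/
def IsStructurallyBalanced {n : ℕ} (X : Matrix (Fin n) (Fin n) ℝ) : Prop :=
  (∀ i, 0 < X i i) ∧
    ∀ i j k, SignType.sign (X i j) * SignType.sign (X j k) * SignType.sign (X k i) = 1

/-- The non-vanishing appraisal condition: the lower limit (in the extended reals) of
`min_{i,j} |X_ij(t)|` is positive. -/
def NonVanishing {n : ℕ} (X : ℕ → Matrix (Fin n) (Fin n) ℝ) : Prop :=
  0 < liminf (fun t => ((minAbs (X t) : ℝ) : EReal)) atTop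

/-- `Y` is block diagonal, with consecutive diagonal blocks of sizes `m 0, …, m (k-1)`, the `i`-th
of the form `α bbᵀ` with `α > 0` and `b` a vector of signs (`α` and `b` may vary with `i`). -/
def IsSignBlockDiagonal {n : ℕ} (Y : Matrix (Fin n) (Fin n) ℝ) : Prop :=
  ∃ (k : ℕ) (m : Fin k → ℕ) (hm : ∑ i, m i = n) (α : Fin k → ℝ) (b : (i : Fin k) → Fin (m i) → ℝ),
    (∀ i, 0 < m i) ∧ (∀ i, 0 < α i) ∧ (∀ i l, b i l = -1 ∨ b i l = 1) ∧
      Y = Matrix.reindex (finSigmaFinEquiv.trans (finCongr hm))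
        (finSigmaFinEquiv.trans (finCongr hm))
        (Matrix.blockDiagonal' fun i => α i • Matrix.vecMulVec (b i) (b i))

/-- The set of matrices `P Y Pᵀ` with nonzero rows, `P` a permutation matrix and `Y` block diagonal
with blocks `α bbᵀ`. -/
def Q (n : ℕ) : Set (Matrix (Fin n) (Fin n) ℝ) :=
  {X | X ∈ nzRow n ∧ ∃ (σ : Equiv.Perm (Fin n)) (Y : Matrix (Fin n) (Fin n) ℝ),
    IsSignBlockDiagonal Y ∧ X = σ.permMatrix ℝ * Y * (σ.permMatrix ℝ).transpose}

/-- (Lyapunov) local stability of `Xs` for the homophily-based model, measured in the max norm: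
solutions that start close enough to `Xs` stay close to it for all times. -/
def IsLocallyStable {n : ℕ} (Xs : Matrix (Fin n) (Fin n) ℝ) : Prop :=
  ∀ ε > 0, ∃ δ > 0, ∀ X : ℕ → Matrix (Fin n) (Fin n) ℝ, IsSolution X →
    maxNorm (X 0 - Xs) < δ → ∀ t, maxNorm (X t - Xs) < ε

end HbM

namespace HbM

variable {n : ℕ}

/-! Each entry `update X i j` is an average, with the row-stochastic `weight X i`, of the entries of
row `j` multiplied by the signs of row `i`. Hence the largest modulus never grows. Conjugation by a
diagonal sign matrix commutes with the update, so a sign pattern `b bᵀ` (`IsAligned`) may be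
replaced by an entrywise positive matrix.

For positive matrices the update is true averaging: any enclosing interval `[lo, hi]` with `lo > 0`
is invariant, which gives stability, and weights bounded below shrink the spread by a fixed factor
every two steps (`IsSolution.contract`). So an aligned solution stays aligned and converges to some
`α b bᵀ`.

If all moduli stay above `m > 0` but alignment never occurs, some two rows agree in one column and
disagree in another. The resulting cancellation spreads and lowers the maximum by a fixed amount
every three steps, which is impossible (`IsSolution.exists_isAligned`). Vanishing 2×2 minors
identify the rank-one elements of `Q` with the matrices `α b bᵀ`. -/

/-- The row-stochastic weights `|X_ik| / ∑ₗ |X_il|`. -/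
noncomputable def weight (X : Matrix (Fin n) (Fin n) ℝ) (i k : Fin n) : ℝ :=
  |X i k| / ∑ l, |X i l|

/-! ### The update as an averaging operator -/

theorem sum_abs_pos {X : Matrix (Fin n) (Fin n) ℝ} {i : Fin n} (h : X i ≠ 0) :
    0 < ∑ l, |X i l| := by
  obtain ⟨k, hk⟩ := Function.ne_iff.1 h
  exact Finset.sum_pos' (fun l _ => abs_nonneg _) ⟨k, Finset.mem_univ _, abs_pos.2 hk⟩

theorem update_apply {X : Matrix (Fin n) (Fin n) ℝ} (hX : X ∈ nzRow n) (i j : Fin n) :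
    update X i j = (∑ k, X i k * X j k) / ∑ l, |X i l| := by
  have hv : (Matrix.mulVec (X.map fun x => |x|) 1) = fun i => ∑ l, |X i l| := by
    ext i
    simp [Matrix.mulVec, dotProduct]
  have hinv : (Matrix.diagonal fun i => ∑ l, |X i l|)⁻¹
      = Matrix.diagonal fun i => (∑ l, |X i l|)⁻¹ := by
    apply Matrix.inv_eq_right_inv
    rw [Matrix.diagonal_mul_diagonal, ← Matrix.diagonal_one]
    congr 1
    ext i
    exact mul_inv_cancel₀ (sum_abs_pos (hX i)).ne'
  rw [update, hv, hinv, Matrix.mul_assoc, Matrix.diagonal_mul, Matrix.mul_apply]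
  simp only [Matrix.transpose_apply]
  rw [div_eq_inv_mul]

theorem weight_nonneg (X : Matrix (Fin n) (Fin n) ℝ) (i k : Fin n) : 0 ≤ weight X i k := by
  unfold weight
  positivity

theorem sum_weight {X : Matrix (Fin n) (Fin n) ℝ} (hX : X ∈ nzRow n) (i : Fin n) :
    ∑ k, weight X i k = 1 := by
  simp only [weight]
  rw [← Finset.sum_div, div_self (sum_abs_pos (hX i)).ne']

theorem le_weight {X : Matrix (Fin n) (Fin n) ℝ} {m M : ℝ} (hm : 0 < m)
    (h1 : ∀ i j, m ≤ |X i j|) (h2 : ∀ i j, |X i j| ≤ M) (i k : Fin n) :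
    m / (n * M) ≤ weight X i k := by
  have hs : ∑ l, |X i l| ≤ n * M := by
    simpa using Finset.sum_le_card_nsmul Finset.univ (fun l => |X i l|) M fun l _ => h2 i l
  have hp : 0 < ∑ l, |X i l| :=
    Finset.sum_pos (fun l _ => hm.trans_le (h1 i l)) ⟨k, Finset.mem_univ _⟩
  exact div_le_div₀ (abs_nonneg _) (h1 i k) hp hs

/-- A weighted average of numbers bounded by `V` drops below `V` if one of them does. -/
theorem sum_mul_le_sub {w y : Fin n → ℝ} {V c e : ℝ} {p : Fin n} (hw : ∀ k, 0 ≤ w k)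
    (hsum : ∑ k, w k = 1) (hy : ∀ k, y k ≤ V) (hc : c ≤ w p) (hp : y p ≤ V - e) (he : 0 ≤ e) :
    ∑ k, w k * y k ≤ V - c * e := by
  have h1 : w p * (V - y p) ≤ ∑ k, w k * (V - y k) :=
    Finset.single_le_sum (f := fun k => w k * (V - y k))
      (fun k _ => mul_nonneg (hw k) (sub_nonneg.2 (hy k))) (Finset.mem_univ p)
  have h2 : ∑ k, w k * (V - y k) = V - ∑ k, w k * y k := by
    simp only [mul_sub, Finset.sum_sub_distrib, ← Finset.sum_mul, hsum, one_mul]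
  have h3 : c * e ≤ w p * (V - y p) :=
    mul_le_mul hc (by linarith) he (hw p)
  linarith

theorem sum_mul_le {w y : Fin n → ℝ} {V : ℝ} (hw : ∀ k, 0 ≤ w k)
    (hsum : ∑ k, w k = 1) (hy : ∀ k, y k ≤ V) : ∑ k, w k * y k ≤ V := by
  calc ∑ k, w k * y k ≤ ∑ k, w k * V :=
        Finset.sum_le_sum fun k _ => mul_le_mul_of_nonneg_left (hy k) (hw k)
    _ = V := by rw [← Finset.sum_mul, hsum, one_mul]

/-- If `Z₁ ≤ W₀ Z₀ᵀ` and `Z₂ ≤ W₁ Z₁ᵀ` with row-stochastic `W₀, W₁ ≥ c`, then a gap at one entry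
of `Z₀` spreads to all entries of `Z₂`. -/
theorem gap_spread {W₀ W₁ Z₀ Z₁ Z₂ : Fin n → Fin n → ℝ} {V c e : ℝ} {p q : Fin n}
    (hW₀ : ∀ i, ∑ k, W₀ i k = 1) (hW₁ : ∀ i, ∑ k, W₁ i k = 1)
    (hc : 0 ≤ c) (hc₀ : ∀ i k, c ≤ W₀ i k) (hc₁ : ∀ i k, c ≤ W₁ i k)
    (h₁ : ∀ i j, Z₁ i j ≤ ∑ k, W₀ i k * Z₀ j k) (h₂ : ∀ i j, Z₂ i j ≤ ∑ k, W₁ i k * Z₁ j k)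
    (hV : ∀ i j, Z₀ i j ≤ V) (he : 0 ≤ e) (hpq : Z₀ p q ≤ V - e) (i j : Fin n) :
    Z₂ i j ≤ V - c * (c * e) := by
  have hn₀ : ∀ i k, 0 ≤ W₀ i k := fun i k => hc.trans (hc₀ i k)
  have hn₁ : ∀ i k, 0 ≤ W₁ i k := fun i k => hc.trans (hc₁ i k)
  have hV₁ : ∀ i j, Z₁ i j ≤ V := fun i j =>
    (h₁ i j).trans (sum_mul_le (hn₀ i) (hW₀ i) (hV j))
  -- The low entry of row `p` first lowers the whole column `p` of `Z₁`; every row of `Z₁` meets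
  -- that column, so the next average lowers every entry.
  have hp₁ : ∀ i, Z₁ i p ≤ V - c * e := fun i =>
    (h₁ i p).trans (sum_mul_le_sub (hn₀ i) (hW₀ i) (hV p) (hc₀ i q) hpq he)
  exact (h₂ i j).trans
    (sum_mul_le_sub (hn₁ i) (hW₁ i) (hV₁ j) (hc₁ i p) (hp₁ j) (mul_nonneg hc he))

theorem abs_mul_sign_eq (x y : ℝ) : x * y = |x| * (SignType.sign x * y) := by
  rw [← mul_assoc, abs_mul_sign]

theorem update_eq_sum_weight {X : Matrix (Fin n) (Fin n) ℝ} (hX : X ∈ nzRow n) (i j : Fin n) :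
    update X i j = ∑ k, weight X i k * (SignType.sign (X i k) * X j k) := by
  rw [update_apply hX, Finset.sum_div]
  refine Finset.sum_congr rfl fun k _ => ?_
  rw [abs_mul_sign_eq, weight]
  ring

theorem abs_sign_mul_le (x y : ℝ) : |(SignType.sign x : ℝ) * y| ≤ |y| := by
  rw [abs_mul]
  refine mul_le_of_le_one_left (abs_nonneg _) ?_
  rcases lt_trichotomy x 0 with h | h | h <;> simp [h]

theorem abs_update_le_sum {X : Matrix (Fin n) (Fin n) ℝ} (hX : X ∈ nzRow n) (i j : Fin n) :
    |update X i j| ≤ ∑ k, weight X i k * |X j k| := by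
  rw [update_eq_sum_weight hX]
  refine (Finset.abs_sum_le_sum_abs _ _).trans (Finset.sum_le_sum fun k _ => ?_)
  rw [abs_mul, abs_of_nonneg (weight_nonneg X i k)]
  exact mul_le_mul_of_nonneg_left (abs_sign_mul_le _ _) (weight_nonneg X i k)

theorem abs_update_le {X : Matrix (Fin n) (Fin n) ℝ} (hX : X ∈ nzRow n) {V : ℝ}
    (hV : ∀ i j, |X i j| ≤ V) (i j : Fin n) : |update X i j| ≤ V :=
  (abs_update_le_sum hX i j).trans (sum_mul_le (weight_nonneg X i) (sum_weight hX i) (hV j))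

/-- A diagonal entry is a sum of squares over a positive row sum. This makes `nzRow` invariant and
gives a positive diagonal from time 1 on. -/
theorem update_diag_pos {X : Matrix (Fin n) (Fin n) ℝ} (hX : X ∈ nzRow n) (i : Fin n) :
    0 < update X i i := by
  rw [update_apply hX]
  refine div_pos ?_ (sum_abs_pos (hX i))
  obtain ⟨k, hk⟩ := Function.ne_iff.1 (hX i)
  exact Finset.sum_pos' (fun l _ => mul_self_nonneg _)
    ⟨k, Finset.mem_univ _, mul_self_pos.2 hk⟩

theorem update_mem_nzRow {X : Matrix (Fin n) (Fin n) ℝ} (hX : X ∈ nzRow n) :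
    update X ∈ nzRow n := fun i h =>
  (update_diag_pos hX i).ne' (congrFun h i)

theorem IsSolution.mem_nzRow {X : ℕ → Matrix (Fin n) (Fin n) ℝ} (hX : IsSolution X)
    (h0 : X 0 ∈ nzRow n) (t : ℕ) : X t ∈ nzRow n := by
  induction t with
  | zero => exact h0
  | succ t ih => rw [hX t]; exact update_mem_nzRow ih

theorem IsSolution.shift {X : ℕ → Matrix (Fin n) (Fin n) ℝ} (hX : IsSolution X) (s : ℕ) :
    IsSolution fun t => X (t + s) := fun t => by
  have := hX (t + s)
  rwa [add_right_comm] at this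

/-! ### Entrywise positive solutions -/

theorem mem_nzRow_of_pos {X : Matrix (Fin n) (Fin n) ℝ} (h : ∀ i j, 0 < X i j) : X ∈ nzRow n :=
  fun i hi => (h i i).ne' (congrFun hi i)

theorem update_eq_of_pos {X : Matrix (Fin n) (Fin n) ℝ} (h : ∀ i j, 0 < X i j) (i j : Fin n) :
    update X i j = ∑ k, weight X i k * X j k := by
  rw [update_eq_sum_weight (mem_nzRow_of_pos h)]
  simp [sign_pos (h i _)]

theorem IsSolution.mem_Icc {Z : ℕ → Matrix (Fin n) (Fin n) ℝ} (hZ : IsSolution Z) {lo hi : ℝ}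
    (hlo : 0 < lo) {s : ℕ} (h0 : ∀ i j, Z s i j ∈ Set.Icc lo hi) {t : ℕ} (hst : s ≤ t)
    (i j : Fin n) : Z t i j ∈ Set.Icc lo hi := by
  induction t, hst using Nat.le_induction generalizing i j with
  | base => exact h0 i j
  | succ t _ ih =>
    have hpos : ∀ i j, 0 < Z t i j := fun i j => hlo.trans_le (ih i j).1
    have hw := sum_weight (mem_nzRow_of_pos hpos) i
    rw [hZ t, update_eq_of_pos hpos]
    refine ⟨?_, sum_mul_le (weight_nonneg _ i) hw fun k => (ih j k).2⟩
    have := sum_mul_le (y := fun k => -Z t j k) (V := -lo) (weight_nonneg _ i) hw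
      fun k => neg_le_neg (ih j k).1
    simp only [mul_neg, Finset.sum_neg_distrib] at this
    linarith

theorem IsSolution.contract {Z : ℕ → Matrix (Fin n) (Fin n) ℝ} (hZ : IsSolution Z) {m M : ℝ}
    (hn : 0 < n) (hm : 0 < m) (hb : ∀ t i j, Z t i j ∈ Set.Icc m M) {t : ℕ} {lo hi : ℝ}
    (hlo : 0 < lo) (h : ∀ i j, Z t i j ∈ Set.Icc lo hi) :
    ∃ lo' hi', 0 < lo' ∧ (∀ i j, Z (t + 2) i j ∈ Set.Icc lo' hi') ∧
      hi' - lo' ≤ (1 - (m / (n * M)) ^ 2 / 2) * (hi - lo) := by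
  have hpos : ∀ t i j, 0 < Z t i j := fun t i j => hm.trans_le (hb t i j).1
  have hM : 0 ≤ M := (hpos 0 ⟨0, hn⟩ ⟨0, hn⟩).le.trans (hb 0 ⟨0, hn⟩ ⟨0, hn⟩).2
  set c := m / (n * M) with hcdef
  have hc : 0 ≤ c := by positivity
  have hW : ∀ t i, ∑ k, weight (Z t) i k = 1 := fun t =>
    sum_weight (mem_nzRow_of_pos (hpos t))
  have hcW : ∀ t i k, c ≤ weight (Z t) i k := fun t i k =>
    le_weight hm (fun i j => (abs_of_pos (hpos t i j)).symm ▸ (hb t i j).1)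
      (fun i j => (abs_of_pos (hpos t i j)).symm ▸ (hb t i j).2) i k
  have hstep : ∀ t i j, Z (t + 1) i j = ∑ k, weight (Z t) i k * Z t j k := fun t i j => by
    rw [hZ t, update_eq_of_pos (hpos t)]
  have h2 : ∀ i j, Z (t + 2) i j ∈ Set.Icc lo hi := hZ.mem_Icc hlo h (by omega)
  have hlohi : 0 ≤ hi - lo :=
    sub_nonneg.2 ((h ⟨0, hn⟩ ⟨0, hn⟩).1.trans (h ⟨0, hn⟩ ⟨0, hn⟩).2)
  -- One entry in the lower half leaves a gap of half the length below `hi`, so the upper end drops;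
  -- otherwise the lower end rises, by the same argument applied to `-Z`.
  rcases le_total (Z t ⟨0, hn⟩ ⟨0, hn⟩) ((lo + hi) / 2) with hmid | hmid
  · refine ⟨lo, hi - c * (c * ((hi - lo) / 2)), hlo, fun i j => ⟨(h2 i j).1, ?_⟩, by
      apply le_of_eq; ring⟩
    exact gap_spread (hW t) (hW (t + 1)) hc (hcW t) (hcW (t + 1))
      (fun i j => (hstep t i j).le) (fun i j => (hstep (t + 1) i j).le) (fun i j => (h i j).2)
      (by linarith) (hmid.trans (by linarith)) i j
  · have hneg : ∀ t i j, -Z (t + 1) i j ≤ ∑ k, weight (Z t) i k * -Z t j k := fun t i j => by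
      simp [hstep t i j]
    have key := gap_spread (V := -lo) (e := (hi - lo) / 2) (hW t) (hW (t + 1)) hc (hcW t)
      (hcW (t + 1)) (hneg t) (hneg (t + 1)) (fun i j => neg_le_neg (h i j).1)
      (by linarith) ((neg_le_neg hmid).trans (by linarith))
    refine ⟨lo + c * (c * ((hi - lo) / 2)), hi, by positivity, fun i j => ⟨?_, (h2 i j).2⟩, by
      apply le_of_eq; ring⟩
    have := key i j
    linarith

theorem IsSolution.tendsto_of_pos {Z : ℕ → Matrix (Fin n) (Fin n) ℝ} (hZ : IsSolution Z)
    (hn : 0 < n) (h0 : ∀ i j, 0 < Z 0 i j) :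
    ∃ α > 0, ∀ i j, Tendsto (fun t => Z t i j) atTop (𝓝 α) := by
  have : Nonempty (Fin n) := ⟨⟨0, hn⟩⟩
  obtain ⟨p, hp⟩ := Finite.exists_min fun p : Fin n × Fin n => Z 0 p.1 p.2
  obtain ⟨q, hq⟩ := Finite.exists_max fun p : Fin n × Fin n => Z 0 p.1 p.2
  set m := Z 0 p.1 p.2
  set M := Z 0 q.1 q.2
  have hm : 0 < m := h0 _ _
  have hM : 0 < M := h0 _ _
  have hmM : m ≤ M := hp q
  have hb0 : ∀ i j, Z 0 i j ∈ Set.Icc m M := fun i j => ⟨hp (i, j), hq (i, j)⟩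
  have hb : ∀ t i j, Z t i j ∈ Set.Icc m M := fun t => hZ.mem_Icc hm hb0 (Nat.zero_le t)
  set r := 1 - (m / (n * M)) ^ 2 / 2 with hr
  have hn' : (1 : ℝ) ≤ n := by exact_mod_cast hn
  have hc0 : 0 < m / (n * M) := by positivity
  have hc1 : m / (n * M) ≤ 1 := by
    rw [div_le_one (by positivity)]
    nlinarith
  have hr0 : 0 ≤ r := by rw [hr]; nlinarith
  have hr1 : r < 1 := by
    have : 0 < (m / (n * M)) ^ 2 := by positivity
    rw [hr]; linarith
  have hint : ∀ k : ℕ, ∃ lo hi, 0 < lo ∧ (∀ i j, Z (2 * k) i j ∈ Set.Icc lo hi) ∧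
      hi - lo ≤ r ^ k * (M - m) := by
    intro k
    induction k with
    | zero => exact ⟨m, M, hm, hb0, by simp⟩
    | succ k ih =>
      obtain ⟨lo, hi, hlo, h, hd⟩ := ih
      obtain ⟨lo', hi', hlo', h', hd'⟩ := hZ.contract hn hm hb hlo h
      refine ⟨lo', hi', hlo', h', ?_⟩
      calc hi' - lo' ≤ r * (hi - lo) := hd'
        _ ≤ r * (r ^ k * (M - m)) := mul_le_mul_of_nonneg_left hd hr0
        _ = r ^ (k + 1) * (M - m) := by ring
  -- Closeness uniform in both times and positions yields at once that one entry is Cauchy and that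
  -- all entries share its limit.
  have hclose : ∀ ε > 0, ∃ N, ∀ s ≥ N, ∀ t ≥ N, ∀ i j k l, |Z s i j - Z t k l| < ε := by
    intro ε hε
    have hlim : Tendsto (fun k : ℕ => r ^ k * (M - m)) atTop (𝓝 0) := by
      simpa using (tendsto_pow_atTop_nhds_zero_of_lt_one hr0 hr1).mul_const (M - m)
    obtain ⟨K, hK⟩ := (hlim.eventually (gt_mem_nhds hε)).exists
    obtain ⟨lo, hi, hlo, h, hd⟩ := hint K
    refine ⟨2 * K, fun s hs t ht i j k l => ?_⟩
    have h1 := hZ.mem_Icc hlo h hs i j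
    have h2 := hZ.mem_Icc hlo h ht k l
    rw [abs_lt]
    constructor <;> linarith [h1.1, h1.2, h2.1, h2.2]
  have hcauchy : CauchySeq fun t => Z t ⟨0, hn⟩ ⟨0, hn⟩ := by
    rw [Metric.cauchySeq_iff]
    intro ε hε
    obtain ⟨N, hN⟩ := hclose ε hε
    exact ⟨N, fun s hs t ht => hN s hs t ht _ _ _ _⟩
  obtain ⟨α, hα⟩ := cauchySeq_tendsto_of_complete hcauchy
  refine ⟨α, hm.trans_le (ge_of_tendsto' hα fun t => (hb t _ _).1), fun i j => ?_⟩
  have hdiff : Tendsto (fun t => Z t i j - Z t ⟨0, hn⟩ ⟨0, hn⟩) atTop (𝓝 0) := by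
    rw [Metric.tendsto_atTop]
    intro ε hε
    obtain ⟨N, hN⟩ := hclose ε hε
    exact ⟨N, fun t ht => by simpa using hN t ht t ht _ _ _ _⟩
  simpa using hdiff.add hα

/-! ### Sign patterns of rank one -/

/-- The matrix `diag(b) X diag(b)`. -/
def signConj (b : Fin n → ℝ) (X : Matrix (Fin n) (Fin n) ℝ) : Matrix (Fin n) (Fin n) ℝ :=
  fun i j => b i * X i j * b j

/-- `b` is a vector of signs. -/
def IsSign (b : Fin n → ℝ) : Prop := ∀ i, b i = -1 ∨ b i = 1

theorem IsSign.mul_self {b : Fin n → ℝ} (hb : IsSign b) (i : Fin n) : b i * b i = 1 := by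
  rcases hb i with h | h <;> simp [h]

theorem IsSign.abs_eq {b : Fin n → ℝ} (hb : IsSign b) (i : Fin n) : |b i| = 1 := by
  rcases hb i with h | h <;> simp [h]

theorem IsSign.signConj_signConj {b : Fin n → ℝ} (hb : IsSign b)
    (X : Matrix (Fin n) (Fin n) ℝ) : signConj b (signConj b X) = X := by
  ext i j
  have : b i * (b i * X i j * b j) * b j = (b i * b i) * X i j * (b j * b j) := by ring
  simp only [signConj, this, hb.mul_self, one_mul, mul_one]

theorem IsSign.abs_signConj {b : Fin n → ℝ} (hb : IsSign b) (X : Matrix (Fin n) (Fin n) ℝ)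
    (i j : Fin n) : |signConj b X i j| = |X i j| := by
  simp [signConj, abs_mul, hb.abs_eq]

theorem IsSign.signConj_mem_nzRow {b : Fin n → ℝ} (hb : IsSign b)
    {X : Matrix (Fin n) (Fin n) ℝ} (hX : X ∈ nzRow n) : signConj b X ∈ nzRow n := fun i h => by
  refine hX i (funext fun j => ?_)
  have := hb.abs_signConj X i j
  rw [h] at this
  simpa using this.symm

theorem IsSign.update_signConj {b : Fin n → ℝ} (hb : IsSign b)
    {X : Matrix (Fin n) (Fin n) ℝ} (hX : X ∈ nzRow n) :
    update (signConj b X) = signConj b (update X) := by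
  ext i j
  rw [update_apply (hb.signConj_mem_nzRow hX)]
  simp only [signConj, update_apply hX]
  have h1 : ∀ k, b i * X i k * b k * (b j * X j k * b k) = b i * b j * (X i k * X j k) :=
    fun k => by
      have : b i * X i k * b k * (b j * X j k * b k)
        = b i * b j * (X i k * X j k) * (b k * b k) := by ring
      rw [this, hb.mul_self, mul_one]
  have h2 : ∀ l, |b i * X i l * b l| = |X i l| := hb.abs_signConj X i
  simp only [h1, h2, ← Finset.mul_sum]
  ring

theorem IsSign.isSolution_signConj {b : Fin n → ℝ} (hb : IsSign b)
    {X : ℕ → Matrix (Fin n) (Fin n) ℝ} (hX : IsSolution X) (h0 : X 0 ∈ nzRow n) :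
    IsSolution fun t => signConj b (X t) := fun t => by
  change signConj b (X (t + 1)) = _
  rw [hb.update_signConj (hX.mem_nzRow h0 t), hX t]

/-- The signs of `X` are those of `b bᵀ`. -/
def IsAligned (b : Fin n → ℝ) (X : Matrix (Fin n) (Fin n) ℝ) : Prop :=
  IsSign b ∧ ∀ i j, 0 < signConj b X i j

theorem IsAligned.mem_nzRow {b : Fin n → ℝ} {X : Matrix (Fin n) (Fin n) ℝ}
    (h : IsAligned b X) : X ∈ nzRow n := by
  rw [← h.1.signConj_signConj X]
  exact h.1.signConj_mem_nzRow (mem_nzRow_of_pos h.2)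

theorem IsAligned.isStructurallyBalanced {b : Fin n → ℝ} {X : Matrix (Fin n) (Fin n) ℝ}
    (h : IsAligned b X) : IsStructurallyBalanced X := by
  obtain ⟨hb, hX⟩ := h
  refine ⟨fun i => ?_, fun i j k => ?_⟩
  · have h1 := hX i i
    have h2 : signConj b X i i = b i * b i * X i i := by simp only [signConj]; ring
    rwa [h2, hb.mul_self, one_mul] at h1
  · rw [← sign_mul, ← sign_mul, sign_eq_one_iff]
    have h1 := mul_pos (mul_pos (hX i j) (hX j k)) (hX k i)
    have h2 : signConj b X i j * signConj b X j k * signConj b X k i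
      = X i j * X j k * X k i * (b i * b i) * (b j * b j) * (b k * b k) := by
      simp only [signConj]; ring
    simpa only [h2, hb.mul_self, mul_one] using h1

/-- The signs of column `o` serve as `b`. -/
theorem exists_isAligned_of_pos {X : Matrix (Fin n) (Fin n) ℝ} (o : Fin n)
    (h : ∀ i j, 0 < X i o * X i j * X j o) : ∃ b, IsAligned b X := by
  refine ⟨fun i => SignType.sign (X i o), fun i => ?_, fun i j => ?_⟩
  · have : X i o ≠ 0 := fun h0 => by simpa [h0] using h i i
    rcases this.lt_or_gt with h | h <;> simp [h]
  · have h1 : X i o * X i j * X j o =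
        SignType.sign (X i o) * X i j * SignType.sign (X j o) * (|X i o| * |X j o|) := by
      conv_lhs => rw [← sign_mul_abs (X i o), ← sign_mul_abs (X j o)]
      ring
    exact pos_of_mul_pos_left (h1 ▸ h i j) (by positivity)

theorem IsStructurallyBalanced.exists_isAligned {X : Matrix (Fin n) (Fin n) ℝ} (hn : 0 < n)
    (h : IsStructurallyBalanced X) : ∃ b, IsAligned b X := by
  obtain ⟨hd, h⟩ := h
  have h' : ∀ i j k, 0 < X i j * X j k * X k i := fun i j k => by
    rw [← sign_eq_one_iff, sign_mul, sign_mul, h]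
  refine exists_isAligned_of_pos ⟨0, hn⟩ fun i j => ?_
  have h1 := h' i j ⟨0, hn⟩
  -- The degenerate triad `0, i, 0` shows that the entries `(0, i)` and `(i, 0)` have equal sign, so
  -- one may replace the other in `h1`.
  have h2 := h' ⟨0, hn⟩ i ⟨0, hn⟩
  have h3 : 0 < X ⟨0, hn⟩ i * X i ⟨0, hn⟩ := pos_of_mul_pos_left h2 (hd _).le
  have h4 := mul_pos h1 h3
  have hne : 0 < X ⟨0, hn⟩ i * X ⟨0, hn⟩ i :=
    mul_self_pos.2 fun h0 => by simp [h0] at h3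
  refine pos_of_mul_pos_left (b := X ⟨0, hn⟩ i * X ⟨0, hn⟩ i) ?_ hne.le
  convert h4 using 1
  ring

theorem IsAligned.tendsto {X : ℕ → Matrix (Fin n) (Fin n) ℝ} (hX : IsSolution X) (hn : 0 < n)
    {b : Fin n → ℝ} {s : ℕ} (h : IsAligned b (X s)) :
    ∃ α : ℝ, 0 < α ∧ Tendsto X atTop (𝓝 (α • Matrix.vecMulVec b b)) := by
  have hZ : IsSolution fun t => signConj b (X (t + s)) :=
    h.1.isSolution_signConj (hX.shift s) (by simpa using h.mem_nzRow)
  obtain ⟨α, hα, hlim⟩ := hZ.tendsto_of_pos hn (by simpa using h.2)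
  refine ⟨α, hα, (tendsto_add_atTop_iff_nat s).1 ?_⟩
  refine tendsto_pi_nhds.2 fun i => tendsto_pi_nhds.2 fun j => ?_
  have h1 := ((hlim i j).const_mul (b i)).mul_const (b j)
  have h2 : ∀ t, b i * signConj b (X (t + s)) i j * b j = X (t + s) i j := fun t =>
    congrFun (congrFun (h.1.signConj_signConj (X (t + s))) i) j
  simp only [h2] at h1
  convert h1 using 2
  simp [Matrix.vecMulVec_apply]
  ring

theorem IsAligned.of_le {X : ℕ → Matrix (Fin n) (Fin n) ℝ} (hX : IsSolution X)
    {b : Fin n → ℝ} {s t : ℕ} (h : IsAligned b (X s)) (hst : s ≤ t) : IsAligned b (X t) := by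
  induction t, hst using Nat.le_induction with
  | base => exact h
  | succ t _ ih =>
    refine ⟨h.1, fun i j => ?_⟩
    have hz := mem_nzRow_of_pos ih.2
    have hi := sum_abs_pos (hz i)
    rw [hX t, ← h.1.update_signConj ih.mem_nzRow, update_apply hz]
    exact div_pos (Finset.sum_pos (fun k _ => mul_pos (ih.2 i k) (ih.2 j k))
      ⟨i, Finset.mem_univ _⟩) hi

/-! ### Solutions with non-vanishing appraisals -/

/-- If the signs of `X` are not those of some `b bᵀ`, then two rows neither agree nor disagree
in all signs. -/
theorem exists_cancel {X : Matrix (Fin n) (Fin n) ℝ} (hn : 0 < n) (hne : ∀ i j, X i j ≠ 0)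
    (hd : ∀ i, 0 < X i i) (h : ¬ ∃ b, IsAligned b X) :
    ∃ i j k l, 0 < X i k * X j k ∧ X i l * X j l < 0 := by
  by_contra! hcon
  refine h (exists_isAligned_of_pos ⟨0, hn⟩ fun i j => ?_)
  have hnn : ∀ i j k, X i k * X j k ≠ 0 := fun i j k => mul_ne_zero (hne _ _) (hne _ _)
  -- Under `hcon` the products of rows `i` and `j` have one sign in all columns; compare columns `0`
  -- and `j`, since `X j j > 0` can then be dropped.
  have key : 0 < X i ⟨0, hn⟩ * X j ⟨0, hn⟩ * (X i j * X j j) := by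
    rcases (hnn i j ⟨0, hn⟩).lt_or_gt with h1 | h1
    · rcases (hnn i j j).lt_or_gt with h2 | h2
      · exact mul_pos_of_neg_of_neg h1 h2
      · exact absurd (hcon i j j ⟨0, hn⟩ h2) (not_le.2 h1)
    · have h2 := hcon i j ⟨0, hn⟩ j h1
      exact mul_pos h1 (h2.lt_of_ne (hnn i j j).symm)
  have e : X i ⟨0, hn⟩ * X j ⟨0, hn⟩ * (X i j * X j j)
      = X i ⟨0, hn⟩ * X i j * X j ⟨0, hn⟩ * X j j := by ring
  exact pos_of_mul_pos_left (e ▸ key) (hd j).le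

/-- The averaged terms lie in `[-V, V]`. The nonnegative one is at least `m` away from `-V` and the
nonpositive one from `V`, so both bounds improve. -/
theorem abs_update_le_of_cancel {X : Matrix (Fin n) (Fin n) ℝ} (hX : X ∈ nzRow n) {c m V : ℝ}
    (hm : 0 ≤ m) (hmV : m ≤ V) (hc : ∀ i k, c ≤ weight X i k)
    (hV : ∀ i j, |X i j| ≤ V) {i j k l : Fin n} (hk : 0 < X i k * X j k)
    (hl : X i l * X j l < 0) : |update X i j| ≤ V - c * m := by
  have hb : ∀ k, |(SignType.sign (X i k) : ℝ) * X j k| ≤ V := fun k =>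
    (abs_sign_mul_le _ _).trans (hV j k)
  have hsk : 0 ≤ (SignType.sign (X i k) : ℝ) * X j k := by
    rw [abs_mul_sign_eq] at hk
    exact (pos_of_mul_pos_right hk (abs_nonneg _)).le
  have hsl : (SignType.sign (X i l) : ℝ) * X j l ≤ 0 := by
    rw [abs_mul_sign_eq] at hl
    exact (neg_of_mul_neg_right hl (abs_nonneg _)).le
  rw [update_eq_sum_weight hX, abs_le]
  constructor
  · have := sum_mul_le_sub (V := V) (y := fun k => -((SignType.sign (X i k) : ℝ) * X j k))
      (weight_nonneg X i) (sum_weight hX i) (fun k => neg_le.1 (abs_le.1 (hb k)).1)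
      (hc i k) (show _ ≤ V - m by linarith) hm
    simp only [mul_neg, Finset.sum_neg_distrib] at this
    linarith
  · exact sum_mul_le_sub (V := V) (weight_nonneg X i) (sum_weight hX i)
      (fun k => (abs_le.1 (hb k)).2) (hc i l) (show _ ≤ V - m by linarith) hm

theorem IsSolution.exists_isAligned {X : ℕ → Matrix (Fin n) (Fin n) ℝ} (hX : IsSolution X)
    (hn : 0 < n) (h0 : X 0 ∈ nzRow n) {m : ℝ} (hm : 0 < m) {T : ℕ} (hT : 0 < T)
    (hlow : ∀ t ≥ T, ∀ i j, m ≤ |X t i j|) :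
    ∃ b, ∃ t ≥ T, IsAligned b (X t) := by
  by_contra! hcon
  have hna : ∀ t ≥ T, ¬ ∃ b, IsAligned b (X t) := fun t ht ⟨b, hb⟩ => hcon b t ht hb
  have : Nonempty (Fin n) := ⟨⟨0, hn⟩⟩
  have hnz := hX.mem_nzRow h0
  obtain ⟨q, hq⟩ := Finite.exists_max fun p : Fin n × Fin n => |X T p.1 p.2|
  set M := |X T q.1 q.2|
  have hmM : m ≤ M := hlow T le_rfl _ _
  have hup : ∀ t ≥ T, ∀ i j, |X t i j| ≤ M := fun t ht => by
    induction t, ht using Nat.le_induction with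
    | base => exact fun i j => hq (i, j)
    | succ t _ ih => rw [hX t]; exact abs_update_le (hnz t) ih
  set c := m / (n * M) with hcdef
  have hc : 0 < c := by
    have : (0 : ℝ) < n := by exact_mod_cast hn
    have := hm.trans_le hmM
    positivity
  have hcW : ∀ t ≥ T, ∀ i k, c ≤ weight (X t) i k := fun t ht =>
    le_weight hm (hlow t ht) (hup t ht)
  have hstep : ∀ t i j, |X (t + 1) i j| ≤ ∑ k, weight (X t) i k * |X t j k| := fun t i j => by
    rw [hX t]; exact abs_update_le_sum (hnz t) i j
  have hdrop : ∀ t ≥ T, ∀ V, (∀ i j, |X t i j| ≤ V) →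
      ∀ i j, |X (t + 3) i j| ≤ V - c * (c * (c * m)) := by
    intro t ht V hV
    have hd : ∀ i, 0 < X t i i := fun i => by
      -- `T > 0` matters here: `X t` is itself an update, hence has positive diagonal.
      obtain ⟨s, rfl⟩ : ∃ s, t = s + 1 := ⟨t - 1, by omega⟩
      rw [hX s]
      exact update_diag_pos (hnz s) i
    have hne : ∀ i j, X t i j ≠ 0 := fun i j => abs_pos.1 (hm.trans_le (hlow t ht i j))
    obtain ⟨i, j, k, l, hk, hl⟩ := exists_cancel hn hne hd (hna t ht)
    have h1 : |X (t + 1) i j| ≤ V - c * m := by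
      rw [hX t]
      exact abs_update_le_of_cancel (hnz t) hm.le ((hlow t ht i j).trans (hV i j)) (hcW t ht)
        hV hk hl
    have hV1 : ∀ i j, |X (t + 1) i j| ≤ V := by rw [hX t]; exact abs_update_le (hnz t) hV
    exact gap_spread (Z₀ := fun i j => |X (t + 1) i j|) (Z₁ := fun i j => |X (t + 2) i j|)
      (Z₂ := fun i j => |X (t + 3) i j|) (sum_weight (hnz (t + 1))) (sum_weight (hnz (t + 2)))
      hc.le (hcW _ (by omega)) (hcW _ (by omega)) (hstep (t + 1)) (hstep (t + 2)) hV1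
      (by positivity) h1
  have hiter : ∀ k : ℕ, ∀ i j, |X (T + 3 * k) i j| ≤ M - k * (c * (c * (c * m))) := by
    intro k
    induction k with
    | zero => simpa using hup T le_rfl
    | succ k ih =>
      intro i j
      have := hdrop (T + 3 * k) (by omega) _ ih i j
      push_cast
      rw [show T + 3 * (k + 1) = T + 3 * k + 3 by ring]
      linarith
  obtain ⟨k, hk⟩ := exists_nat_gt (M / (c * (c * (c * m))))
  rw [div_lt_iff₀ (by positivity)] at hk
  have := hiter k ⟨0, hn⟩ ⟨0, hn⟩
  linarith [abs_nonneg (X (T + 3 * k) ⟨0, hn⟩ ⟨0, hn⟩)]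

/-! ### Elements of rank one of `Q` -/

theorem mul_eq_mul_of_rank_eq_one {X : Matrix (Fin n) (Fin n) ℝ} (h : X.rank = 1)
    (i j : Fin n) : X i i * X j j = X i j * X j i := by
  by_contra hne
  have hdet : (X.submatrix ![i, j] ![i, j]).det ≠ 0 := by
    rw [Matrix.det_fin_two]
    simpa [sub_eq_zero] using hne
  have h1 := Matrix.rank_submatrix_le X ![i, j] ![i, j]
  rw [Matrix.rank_of_isUnit _ ((Matrix.isUnit_iff_isUnit_det _).2 hdet.isUnit), h] at h1
  simp at h1

theorem exists_eq_of_mem_Q (hn : 0 < n) {X : Matrix (Fin n) (Fin n) ℝ} (hX : X ∈ Q n)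
    (hr : X.rank = 1) : ∃ (α : ℝ) (b : Fin n → ℝ), 0 < α ∧ IsSign b ∧
      X = α • Matrix.vecMulVec b b := by
  obtain ⟨-, σ, Y, ⟨k, m, hm, α, b, hmpos, hα, hb, rfl⟩, rfl⟩ := hX
  set X := σ.permMatrix ℝ * (Matrix.reindex (finSigmaFinEquiv.trans (finCongr hm))
    (finSigmaFinEquiv.trans (finCongr hm))
    (Matrix.blockDiagonal' fun i => α i • Matrix.vecMulVec (b i) (b i))) *
      (σ.permMatrix ℝ).transpose with hXdef
  let g : Fin n → Σ i, Fin (m i) := fun i => (finSigmaFinEquiv.trans (finCongr hm)).symm (σ i)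
  let B : Fin n → ℝ := fun i => b (g i).1 (g i).2
  have hblock : ∀ p q : Σ i, Fin (m i),
      Matrix.blockDiagonal' (fun i => α i • Matrix.vecMulVec (b i) (b i)) p q
        = if p.1 = q.1 then α p.1 * (b p.1 p.2 * b q.1 q.2) else 0 := by
    rintro ⟨i, a⟩ ⟨j, c⟩
    by_cases hij : i = j
    · subst hij
      simp [Matrix.blockDiagonal'_apply_eq, Matrix.vecMulVec_apply]
    · simp [Matrix.blockDiagonal'_apply_ne _ _ _ hij, hij]
  have hentry : ∀ i j, X i j
      = if (g i).1 = (g j).1 then α (g i).1 * (B i * B j) else 0 := by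
    intro i j
    rw [hXdef, ← PEquiv.toMatrix_symm, ← Equiv.toPEquiv_symm, PEquiv.toMatrix_toPEquiv_mul,
      PEquiv.mul_toMatrix_toPEquiv]
    exact hblock (g i) (g j)
  have hB : IsSign B := fun i => hb _ _
  -- Indices in different blocks would give a 2×2 principal minor with zero off-diagonal and
  -- positive diagonal entries.
  have hsame : ∀ i j, (g i).1 = (g j).1 := by
    intro i j
    by_contra hij
    have h1 := mul_eq_mul_of_rank_eq_one hr i j
    rw [hentry i j, if_neg hij, hentry i i, hentry j j, if_pos rfl, if_pos rfl, hB.mul_self,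
      hB.mul_self] at h1
    have := mul_pos (hα (g i).1) (hα (g j).1)
    simp at h1
    rcases h1 with h1 | h1
    · exact (hα _).ne' h1
    · exact (hα _).ne' h1
  refine ⟨α (g ⟨0, hn⟩).1, B, hα _, hB, ?_⟩
  ext i j
  rw [hentry, if_pos (hsame i j), hsame i ⟨0, hn⟩]
  simp [Matrix.vecMulVec_apply]

theorem smul_vecMulVec_mem_Q (hn : 0 < n) {α : ℝ} (hα : 0 < α) {b : Fin n → ℝ}
    (hb : IsSign b) : α • Matrix.vecMulVec b b ∈ Q n := by
  have hne : ∀ i, b i ≠ 0 := fun i h => by simpa [h] using hb.mul_self i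
  refine ⟨fun i h => ?_, 1, _, ⟨1, fun _ => n, by simp, fun _ => α, fun _ => b, fun _ => hn,
    fun _ => hα, fun _ => hb, rfl⟩, ?_⟩
  · have := congrFun h i
    simp [Matrix.vecMulVec_apply, hne, hα.ne'] at this
  · have h1 : (Equiv.Perm.permMatrix ℝ (1 : Equiv.Perm (Fin n))) = 1 := by simp
    rw [h1, Matrix.transpose_one, Matrix.one_mul, Matrix.mul_one]
    ext i j
    obtain ⟨⟨p, i'⟩, rfl⟩ :=
      (finSigmaFinEquiv.trans (finCongr (show ∑ _ : Fin 1, n = n by simp))).surjective i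
    obtain ⟨⟨q, j'⟩, rfl⟩ :=
      (finSigmaFinEquiv.trans (finCongr (show ∑ _ : Fin 1, n = n by simp))).surjective j
    obtain rfl := Subsingleton.elim q p
    -- With a single block the reindexing is the identity.
    have he : ∀ r : Fin n, (finSigmaFinEquiv.trans (finCongr (show ∑ _ : Fin 1, n = n by simp)))
        ⟨q, r⟩ = r := fun r => by
      obtain rfl := Subsingleton.elim q 0
      ext
      simp [finSigmaFinEquiv_apply]
    rw [Matrix.reindex_apply, Matrix.submatrix_apply, Equiv.symm_apply_apply,
      Equiv.symm_apply_apply, Matrix.blockDiagonal'_apply_eq, he, he]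

theorem rank_smul_vecMulVec (hn : 0 < n) {α : ℝ} (hα : 0 < α) {b : Fin n → ℝ}
    (hb : IsSign b) : (α • Matrix.vecMulVec b b).rank = 1 := by
  apply le_antisymm
  · rw [← Matrix.smul_vecMulVec]
    exact Matrix.rank_vecMulVec_le _ _
  · have hdet : ((α • Matrix.vecMulVec b b).submatrix
        (fun _ : Fin 1 => (⟨0, hn⟩ : Fin n)) (fun _ : Fin 1 => ⟨0, hn⟩)).det ≠ 0 := by
      simp [Matrix.vecMulVec_apply, hb.mul_self, hα.ne']
    have h1 := Matrix.rank_submatrix_le (α • Matrix.vecMulVec b b)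
      (fun _ : Fin 1 => (⟨0, hn⟩ : Fin n)) (fun _ : Fin 1 => ⟨0, hn⟩)
    rwa [Matrix.rank_of_isUnit _ ((Matrix.isUnit_iff_isUnit_det _).2 hdet.isUnit),
      Fintype.card_fin] at h1

theorem IsSign.signConj_smul_vecMulVec {b : Fin n → ℝ} (hb : IsSign b) (α : ℝ) (i j : Fin n) :
    signConj b (α • Matrix.vecMulVec b b) i j = α := by
  have h1 : signConj b (α • Matrix.vecMulVec b b) i j = α * (b i * b i) * (b j * b j) := by
    simp only [signConj, Matrix.smul_apply, Matrix.vecMulVec_apply, smul_eq_mul]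
    ring
  rw [h1, hb.mul_self, hb.mul_self, mul_one, mul_one]

theorem IsSign.isAligned_smul_vecMulVec {b : Fin n → ℝ} (hb : IsSign b) {α : ℝ} (hα : 0 < α) :
    IsAligned b (α • Matrix.vecMulVec b b) :=
  ⟨hb, fun i j => by rwa [hb.signConj_smul_vecMulVec]⟩

theorem IsSign.update_smul_vecMulVec {b : Fin n → ℝ} (hb : IsSign b) {α : ℝ} (hα : 0 < α) :
    update (α • Matrix.vecMulVec b b) = α • Matrix.vecMulVec b b := by
  have hA := hb.isAligned_smul_vecMulVec hα
  rw [← hb.signConj_signConj (update _), ← hb.update_signConj hA.mem_nzRow]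
  conv_rhs => rw [← hb.signConj_signConj (α • Matrix.vecMulVec b b)]
  congr 1
  ext i j
  rw [update_eq_of_pos hA.2, ← Finset.sum_congr rfl fun k _ => by
    rw [hb.signConj_smul_vecMulVec], ← Finset.sum_mul, sum_weight (mem_nzRow_of_pos hA.2),
    one_mul, hb.signConj_smul_vecMulVec]

/-! ### Norms and limits -/

theorem abs_le_maxNorm (X : Matrix (Fin n) (Fin n) ℝ) (i j : Fin n) : |X i j| ≤ maxNorm X :=
  le_ciSup (f := fun p : Fin n × Fin n => |X p.1 p.2|) (Set.finite_range _).bddAbove (i, j)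

theorem minAbs_le_abs (X : Matrix (Fin n) (Fin n) ℝ) (i j : Fin n) : minAbs X ≤ |X i j| :=
  ciInf_le (f := fun p : Fin n × Fin n => |X p.1 p.2|) (Set.finite_range _).bddBelow (i, j)

theorem maxNorm_le (hn : 0 < n) {X : Matrix (Fin n) (Fin n) ℝ} {V : ℝ}
    (h : ∀ i j, |X i j| ≤ V) : maxNorm X ≤ V := by
  have : Nonempty (Fin n) := ⟨⟨0, hn⟩⟩
  exact ciSup_le fun p => h p.1 p.2

theorem le_minAbs (hn : 0 < n) {X : Matrix (Fin n) (Fin n) ℝ} {V : ℝ}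
    (h : ∀ i j, V ≤ |X i j|) : V ≤ minAbs X := by
  have : Nonempty (Fin n) := ⟨⟨0, hn⟩⟩
  exact le_ciInf fun p => h p.1 p.2

theorem isLocallyStable_smul_vecMulVec (hn : 0 < n) {α : ℝ} (hα : 0 < α) {b : Fin n → ℝ}
    (hb : IsSign b) : IsLocallyStable (α • Matrix.vecMulVec b b) := by
  intro ε hε
  -- `δ < α` keeps the invariant interval `[α - δ, α + δ]` positive; `δ < ε` turns the closed bound
  -- into a strict one.
  obtain ⟨δ, hδ, hδm⟩ := exists_between (lt_min hε hα)
  obtain ⟨hδε, hδα⟩ := lt_min_iff.1 hδm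
  have hconj : ∀ (Y : Matrix (Fin n) (Fin n) ℝ) i j,
      |(Y - α • Matrix.vecMulVec b b) i j| ≤ δ ↔
        signConj b Y i j ∈ Set.Icc (α - δ) (α + δ) := by
    intro Y i j
    rw [← hb.abs_signConj]
    have : signConj b (Y - α • Matrix.vecMulVec b b) i j = signConj b Y i j - α := by
      have h1 := hb.signConj_smul_vecMulVec α i j
      simp only [signConj, Matrix.sub_apply] at h1 ⊢
      linarith
    rw [this, abs_le, Set.mem_Icc]
    constructor <;> rintro ⟨h1, h2⟩ <;> constructor <;> linarith
  refine ⟨δ, hδ, fun X hX h t => (maxNorm_le hn fun i j => ?_).trans_lt hδε⟩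
  have h0 : ∀ i j, signConj b (X 0) i j ∈ Set.Icc (α - δ) (α + δ) := fun i j =>
    (hconj _ i j).1 ((abs_le_maxNorm _ i j).trans h.le)
  have hA : IsAligned b (X 0) := ⟨hb, fun i j => (sub_pos.2 hδα).trans_le (h0 i j).1⟩
  exact (hconj _ i j).2 ((hb.isSolution_signConj hX hA.mem_nzRow).mem_Icc (sub_pos.2 hδα) h0
    (Nat.zero_le t) i j)

theorem NonVanishing.exists_le {X : ℕ → Matrix (Fin n) (Fin n) ℝ} (h : NonVanishing X) :
    ∃ m > 0, ∃ T > 0, ∀ t ≥ T, ∀ i j, m ≤ |X t i j| := by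
  obtain ⟨m, hm0, hm⟩ := EReal.lt_iff_exists_real_btwn.1 h
  obtain ⟨T, hT⟩ := eventually_atTop.1 (eventually_lt_of_lt_liminf hm)
  refine ⟨m, by exact_mod_cast hm0, T + 1, T.succ_pos, fun t ht i j => ?_⟩
  exact (EReal.coe_lt_coe_iff.1 (hT t (by omega))).le.trans (minAbs_le_abs _ i j)

theorem nonVanishing_of_tendsto (hn : 0 < n) {X : ℕ → Matrix (Fin n) (Fin n) ℝ}
    {α : ℝ} (hα : 0 < α) {b : Fin n → ℝ} (hb : IsSign b)
    (h : Tendsto X atTop (𝓝 (α • Matrix.vecMulVec b b))) : NonVanishing X := by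
  have hev : ∀ᶠ t in atTop, ∀ i j, α / 2 < |X t i j| := by
    refine eventually_all.2 fun i => eventually_all.2 fun j => ?_
    have h1 := (tendsto_pi_nhds.1 (tendsto_pi_nhds.1 h i) j).abs
    refine h1.eventually (lt_mem_nhds ?_)
    have h2 : |(α • Matrix.vecMulVec b b) i j| = α := by
      simp [Matrix.vecMulVec_apply, abs_mul, hb.abs_eq, abs_of_pos hα]
    rw [h2]
    exact half_lt_self hα
  refine lt_of_lt_of_le (b := ((α / 2 : ℝ) : EReal)) (by exact_mod_cast half_pos hα)
    (le_liminf_of_le (h := hev.mono fun t ht => ?_))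
  exact EReal.coe_le_coe_iff.2 (le_minAbs hn fun i j => (ht i j).le)

end HbM

theorem theorem3p7 (n : ℕ) (hn : 0 < n) :
    (∀ Xs ∈ HbM.Q n, Xs.rank = 1 → HbM.update Xs = Xs ∧ HbM.IsLocallyStable Xs) ∧
    (∀ X : ℕ → Matrix (Fin n) (Fin n) ℝ, HbM.IsSolution X → X 0 ∈ HbM.nzRow n →
      List.TFAE [
        HbM.NonVanishing X,
        ∃ t₀ > 0, ∀ t ≥ t₀, HbM.IsStructurallyBalanced (X t),
        ∃ Xs ∈ HbM.Q n, Xs.rank = 1 ∧ Tendsto X atTop (𝓝 Xs)]) := by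
  refine ⟨fun Xs hQ hr => ?_, fun X hX h0 => ?_⟩
  · obtain ⟨α, b, hα, hb, rfl⟩ := HbM.exists_eq_of_mem_Q hn hQ hr
    exact ⟨hb.update_smul_vecMulVec hα, HbM.isLocallyStable_smul_vecMulVec hn hα hb⟩
  · tfae_have 1 → 2 := fun h => by
      obtain ⟨m, hm, T, hT, hlow⟩ := h.exists_le
      obtain ⟨b, t, ht, hb⟩ := hX.exists_isAligned hn h0 hm hT hlow
      exact ⟨t, hT.trans_le ht, fun s hs => (hb.of_le hX hs).isStructurallyBalanced⟩
    tfae_have 2 → 3 := fun ⟨t, _, ht⟩ => by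
      obtain ⟨b, hb⟩ := (ht t le_rfl).exists_isAligned hn
      obtain ⟨α, hα, hlim⟩ := hb.tendsto hX hn
      exact ⟨_, HbM.smul_vecMulVec_mem_Q hn hα hb.1, HbM.rank_smul_vecMulVec hn hα hb.1, hlim⟩
    tfae_have 3 → 1 := fun ⟨Xs, hQ, hr, hlim⟩ => by
      obtain ⟨α, b, hα, hb, rfl⟩ := HbM.exists_eq_of_mem_Q hn hQ hr
      exact HbM.nonVanishing_of_tendsto hn hα hb hlim
    tfae_finish
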